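/- Let $n\ge 1$ and $0\le m\le n$ be integers, and put \[ p(n,d)=\frac{1}{2^{n-1}}\sum_{j=0}^{d-1}\binom{n-1}{j}\qquad(d\ge 0). \] Call a vector $x\in\mathbf R^n$ positive if $x_j\ge 0$ for all $j$ and $x_j>0$ for at least one $j$. Let $A$ be a random real $m\times n$ matrix whose columns $z_1,\dots,z_n$ are independent random vectors in $\mathbf R^m$, not necessarily identically distributed, each having a probability density $f_j$ with respect to Lebesgue measure that is symmetric with respect to the origin, $f_j(-z)=f_j(z)$. Let $V\subseteq\mathbf R^n$ be the row space of $A$ and $V^\perp$ its orthogonal complement. Then: 1. The probability that the convex hull of $z_1,\dots,z_n$ does not contain the origin is $p(n,m)$. 2. Almost surely $\dim V=m$. 3. The probability that $V$ contains a positive vector is $p(n,m)$. 4. The probability that $V^\perp$ contains a positive vector is $p(n,n-m)$. 5. Almost surely, exactly one of $V$ and $V^\perp$ contains a positive vector. 6. $p(n,m)+p(n,n-m)=1$. -/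

import Mathlib

open MeasureTheory ProbabilityTheory

namespace RandomSubspace

/-- A vector is positive if all its coordinates are nonnegative and at least one is positive. -/
def IsPositive {n : ℕ} (x : EuclideanSpace ℝ (Fin n)) : Prop :=
  (∀ j, 0 ≤ x j) ∧ ∃ j, 0 < x j

/-- The subspace `V` contains a positive vector. -/
def ContainsPositive {n : ℕ} (V : Submodule ℝ (EuclideanSpace ℝ (Fin n))) : Prop :=
  ∃ x ∈ V, IsPositive x

/-- The row space of a real `m × n` matrix, as a subspace of Euclidean `n`-space. -/
noncomputable def rowSpace {m n : ℕ} (A : Matrix (Fin m) (Fin n) ℝ) :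
    Submodule ℝ (EuclideanSpace ℝ (Fin n)) :=
  Submodule.span ℝ (Set.range fun i => WithLp.toLp 2 (A.row i))

/-- The random vector `z` in `ℝ^m` has a density (with respect to Lebesgue measure) that is
symmetric with respect to the origin. -/
def HasSymmetricDensity {Ω : Type*} [MeasurableSpace Ω] {m : ℕ} (z : Ω → (Fin m → ℝ))
    (μ : Measure Ω) : Prop :=
  ∃ f : (Fin m → ℝ) → ENNReal, Measurable f ∧ (∀ x, f (-x) = f x) ∧
    Measure.map z μ = volume.withDensity f

/-- `p(n, d) = 2^{-(n-1)} ∑_{j=0}^{d-1} (n-1 choose j)`, for `n ≥ 1`. -/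
noncomputable def p (n d : ℕ) : ℝ :=
  1 / 2 ^ (n - 1) * ∑ j ∈ Finset.range d, ((n - 1).choose j : ℝ)

end RandomSubspace

/-!
Wendel's argument. Since each column has a symmetric law and the columns are independent, changing
the signs of the columns `z j` does not change their joint law (`measurePreserving_smul_unit`).
Hence the probability that the convex hull misses the origin is the expected proportion of sign
vectors `ε` for which the hull of the `ε j • z j` misses the origin. By separation, `ε` has this
property exactly when some `x` satisfies `0 < ε j * (z j ⬝ᵥ x)` for all `j`, that is, when `ε` is
the sign pattern of a region of the arrangement of the hyperplanes orthogonal to the columns.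

The number of regions does not depend on the columns once they are in general position: it is
`2 * ∑ j < m, (n - 1).choose j` (`ncard_signPatterns`). This follows by induction on the number of
hyperplanes, since a new hyperplane adds as many regions as the old ones cut out on it
(`ncard_signPatterns_succ`), in a space of one dimension less. General position holds almost surely
because, given the other columns, a column with a density avoids any fixed proper subspace
(`ae_generalPosition`). Dividing by `2 ^ n` gives `p n m` (`pi_zero_notMem_convexHull`).

The statements about subspaces reduce to this event. The coefficients of a convex combination
equal to zero form, up to scaling, a positive vector of the orthogonal complement of the row space
(`containsPositive_orthogonal_iff`). In general position the row space contains a positive vector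
exactly when the hull misses the origin: a separating functional gives a strictly positive one, and
conversely a positive vector in the row space and one in its complement would have disjoint
supports, hence produce a linear relation among at most `m` columns
(`zero_notMem_convexHull_of_containsPositive`).
-/

namespace RandomSubspace

/-! ### Counting sign patterns of linear functionals -/

/-- A family of vectors (or functionals) is in general position up to size `d` if every subfamily
of at most `d` members is linearly independent. -/
def GeneralPosition {ι E : Type*} [AddCommGroup E] [Module ℝ E] (d : ℕ) (v : ι → E) : Prop :=
  ∀ s : Finset ι, s.card ≤ d → LinearIndepOn ℝ v (s : Set ι)

/-- The sign patterns `ε` for which the functionals `ε j • φ j` are simultaneously positive at some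
point; they correspond to the regions cut out by the hyperplanes `φ j = 0`. -/
def signPatterns {ι E : Type*} [AddCommGroup E] [Module ℝ E] (φ : ι → Module.Dual ℝ E) :
    Set (ι → ℤˣ) :=
  {ε | ∃ x, ∀ j, 0 < (ε j • φ j) x}

lemma signPatterns_eq_univ_of_isEmpty {ι E : Type*} [IsEmpty ι] [AddCommGroup E] [Module ℝ E]
    (φ : ι → Module.Dual ℝ E) : signPatterns φ = Set.univ :=
  Set.eq_univ_of_forall fun _ => ⟨0, fun j => isEmptyElim j⟩

lemma signPatterns_eq_empty {ι E : Type*} [Nonempty ι] [AddCommGroup E] [Module ℝ E]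
    [Subsingleton E] (φ : ι → Module.Dual ℝ E) : signPatterns φ = ∅ := by
  refine Set.eq_empty_of_forall_notMem ?_
  rintro ε ⟨x, hx⟩
  obtain ⟨j⟩ := ‹Nonempty ι›
  have := hx j
  rw [Subsingleton.elim x 0, map_zero] at this
  exact lt_irrefl _ this

lemma smul_unit_apply {E : Type*} [AddCommGroup E] [Module ℝ E] (e : ℤˣ) (f : Module.Dual ℝ E)
    (x : E) : (e • f) x = ((e : ℤ) : ℝ) * f x := by
  rcases Int.units_eq_one_or e with rfl | rfl <;> simp [Units.smul_def]

section Induction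

variable {n : ℕ} {E : Type*} [AddCommGroup E] [Module ℝ E]

/-- The restrictions of the functionals `φ 1, …, φ n` to the hyperplane `φ 0 = 0`. -/
def restrictKer (φ : Fin (n + 1) → Module.Dual ℝ E) (j : Fin n) :
    Module.Dual ℝ (LinearMap.ker (φ 0)) :=
  (φ j.succ).domRestrict _

/-- If finitely many functionals are positive at `x`, they stay so after a small step in direction
`v`. -/
lemma exists_pos_forall_pos_add_smul (ψ : Fin n → Module.Dual ℝ E) {x : E}
    (hx : ∀ j, 0 < ψ j x) (v : E) : ∃ δ : ℝ, 0 < δ ∧ ∀ j, 0 < ψ j (x + δ • v) := by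
  have h : ∀ j, ∀ᶠ δ in nhdsWithin (0 : ℝ) (Set.Ioi 0), 0 < ψ j (x + δ • v) := by
    intro j
    have hc : Continuous fun δ : ℝ => ψ j (x + δ • v) := by
      simp only [map_add, map_smul, smul_eq_mul]
      fun_prop
    refine nhdsWithin_le_nhds (hc.continuousAt.eventually (lt_mem_nhds ?_))
    simpa using hx j
  obtain ⟨δ, hδ, hpos⟩ := ((Filter.eventually_all.2 h).and self_mem_nhdsWithin).exists
  exact ⟨δ, hpos, hδ⟩

/-- A region of the restricted arrangement extends to regions on both sides of the hyperplane
`φ 0 = 0`. -/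
lemma cons_mem_signPatterns_of_restrictKer {φ : Fin (n + 1) → Module.Dual ℝ E} (h0 : φ 0 ≠ 0)
    {ε : Fin n → ℤˣ} (h : ε ∈ signPatterns (restrictKer φ)) (e : ℤˣ) :
    (Fin.cons e ε : Fin (n + 1) → ℤˣ) ∈ signPatterns φ := by
  obtain ⟨x, hx⟩ := h
  obtain ⟨w, hw⟩ : ∃ w, 0 < (e • φ 0) w := by
    obtain ⟨v, hv⟩ : ∃ v, (e • φ 0) v ≠ 0 := by
      by_contra! hall
      exact h0 ((smul_eq_zero_iff_eq e).1 (LinearMap.ext hall))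
    rcases hv.lt_or_gt with hv | hv
    · exact ⟨-v, by simpa using hv⟩
    · exact ⟨v, hv⟩
  obtain ⟨δ, hδ, hpos⟩ := exists_pos_forall_pos_add_smul (fun j => ε j • φ j.succ) (x := x.1)
    (fun j => by simpa [restrictKer] using hx j) w
  refine ⟨x + δ • w, Fin.cases ?_ fun j => by simpa using hpos j⟩
  have hx0 : φ 0 x.1 = 0 := x.2
  have : (e • φ 0) x.1 = 0 := by rw [smul_unit_apply, hx0, mul_zero]
  rw [Fin.cons_zero, map_add, this, map_smul, zero_add]
  exact mul_pos hδ hw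

/-- A region on which `φ 0` takes both signs meets the hyperplane `φ 0 = 0`. -/
lemma mem_signPatterns_restrictKer {φ : Fin (n + 1) → Module.Dual ℝ E} {ε : Fin n → ℤˣ}
    (hp : (Fin.cons 1 ε : Fin (n + 1) → ℤˣ) ∈ signPatterns φ)
    (hn : (Fin.cons (-1) ε : Fin (n + 1) → ℤˣ) ∈ signPatterns φ) :
    ε ∈ signPatterns (restrictKer φ) := by
  obtain ⟨x, hx⟩ := hp
  obtain ⟨y, hy⟩ := hn
  have hx0 : 0 < φ 0 x := by simpa using hx 0
  have hy0 : φ 0 y < 0 := by simpa [smul_unit_apply] using hy 0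
  have hmem : (-φ 0 y) • x + φ 0 x • y ∈ LinearMap.ker (φ 0) := by
    rw [LinearMap.mem_ker, map_add, map_smul, map_smul, smul_eq_mul, smul_eq_mul]
    ring
  refine ⟨⟨_, hmem⟩, fun j => ?_⟩
  have h1 : 0 < (ε j • φ j.succ) x := by simpa using hx j.succ
  have h2 : 0 < (ε j • φ j.succ) y := by simpa using hy j.succ
  have : (ε j • restrictKer φ j) ⟨_, hmem⟩ =
      (ε j • φ j.succ) ((-φ 0 y) • x + φ 0 x • y) := by
    simp [restrictKer]
  rw [this, map_add, map_smul, map_smul]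
  exact add_pos (mul_pos (neg_pos.2 hy0) h1) (mul_pos hx0 h2)

/-- Deletion and restriction: adding a hyperplane to an arrangement creates as many regions as
there are in the arrangement induced on that hyperplane. -/
lemma ncard_signPatterns_succ (φ : Fin (n + 1) → Module.Dual ℝ E) (h0 : φ 0 ≠ 0) :
    (signPatterns φ).ncard =
      (signPatterns fun j : Fin n => φ j.succ).ncard + (signPatterns (restrictKer φ)).ncard := by
  -- A region of the smaller arrangement is open, so it is not contained in the new hyperplane.
  have hne : ∀ ε, ε ∈ signPatterns (fun j : Fin n => φ j.succ) → ∃ x, φ 0 x ≠ 0 ∧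
      ∀ j, 0 < (ε j • φ j.succ) x := by
    rintro ε ⟨x, hx⟩
    by_cases hx0 : φ 0 x = 0
    · obtain ⟨v, hv⟩ := DFunLike.ne_iff.1 h0
      obtain ⟨δ, hδ, hpos⟩ := exists_pos_forall_pos_add_smul (fun j => ε j • φ j.succ) hx v
      exact ⟨x + δ • v, by simpa [hx0, hδ.ne'] using hv, hpos⟩
    · exact ⟨x, hx0, hx⟩
  set P : ℤˣ → Set (Fin n → ℤˣ) := fun e =>
    {ε | (Fin.cons e ε : Fin (n + 1) → ℤˣ) ∈ signPatterns φ}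
  have hunion : P 1 ∪ P (-1) = signPatterns fun j : Fin n => φ j.succ := by
    ext ε
    constructor
    · rintro (⟨x, hx⟩ | ⟨x, hx⟩) <;> exact ⟨x, fun j => by simpa using hx j.succ⟩
    · intro hε
      obtain ⟨x, hx0, hx⟩ := hne ε hε
      rcases hx0.lt_or_gt with h | h
      · exact Or.inr ⟨x, Fin.cases (by simpa [smul_unit_apply] using h)
          fun j => by simpa using hx j⟩
      · exact Or.inl ⟨x, Fin.cases (by simpa using h) fun j => by simpa using hx j⟩
  have hinter : P 1 ∩ P (-1) = signPatterns (restrictKer φ) := by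
    ext ε
    exact ⟨fun h => mem_signPatterns_restrictKer h.1 h.2, fun h =>
      ⟨cons_mem_signPatterns_of_restrictKer h0 h _, cons_mem_signPatterns_of_restrictKer h0 h _⟩⟩
  have hsplit : signPatterns φ = (fun ε : Fin n → ℤˣ => (Fin.cons 1 ε : Fin (n + 1) → ℤˣ)) '' P 1 ∪
      (fun ε : Fin n → ℤˣ => (Fin.cons (-1) ε : Fin (n + 1) → ℤˣ)) '' P (-1) := by
    ext ε
    constructor
    · intro hε
      rw [← Fin.cons_self_tail ε] at hε
      rcases Int.units_eq_one_or (ε 0) with h | h <;> rw [h] at hε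
      · exact Or.inl ⟨Fin.tail ε, hε, by rw [← h]; exact Fin.cons_self_tail ε⟩
      · exact Or.inr ⟨Fin.tail ε, hε, by rw [← h]; exact Fin.cons_self_tail ε⟩
    · rintro (⟨ε, hε, rfl⟩ | ⟨ε, hε, rfl⟩) <;> exact hε
  have hdisj : Disjoint ((fun ε : Fin n → ℤˣ => (Fin.cons 1 ε : Fin (n + 1) → ℤˣ)) '' P 1)
      ((fun ε : Fin n → ℤˣ => (Fin.cons (-1) ε : Fin (n + 1) → ℤˣ)) '' P (-1)) := by
    rw [Set.disjoint_left]
    rintro _ ⟨ε, -, rfl⟩ ⟨ε', -, h⟩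
    have := congrFun h 0
    simp at this
  rw [hsplit, Set.ncard_union_eq hdisj,
    Set.ncard_image_of_injective _ (Fin.cons_right_injective (α := fun _ => ℤˣ) 1),
    Set.ncard_image_of_injective _ (Fin.cons_right_injective (α := fun _ => ℤˣ) (-1)),
    ← Set.ncard_union_add_ncard_inter, hunion, hinter]

lemma GeneralPosition.ne_zero {ι : Type*} {d : ℕ} {v : ι → E} (h : GeneralPosition d v)
    (hd : 1 ≤ d) (i : ι) : v i ≠ 0 :=
  (h {i} (by simpa using hd)).ne_zero (by simp)

lemma GeneralPosition.comp_succ {d : ℕ} {v : Fin (n + 1) → E} (h : GeneralPosition d v) :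
    GeneralPosition d fun j : Fin n => v j.succ := by
  intro s hs
  have := h (s.map (Fin.succEmb n)) (by simpa using hs)
  rw [Finset.coe_map] at this
  exact (LinearIndepOn.comp_of_image this (Fin.succ_injective n).injOn)

/-- Functionals vanishing on `ker (φ 0)` are multiples of `φ 0`, so restricting to that hyperplane
costs exactly one degree of independence. -/
lemma GeneralPosition.restrictKer {d : ℕ} {φ : Fin (n + 1) → Module.Dual ℝ E}
    (h : GeneralPosition (d + 1) φ) : GeneralPosition d (restrictKer φ) := by
  intro s hs
  let r : Module.Dual ℝ E →ₗ[ℝ] Module.Dual ℝ (LinearMap.ker (φ 0)) :=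
    (LinearMap.ker (φ 0)).subtype.dualMap
  have hker : LinearMap.ker r ≤ Submodule.span ℝ {φ 0} := by
    intro f hf
    have : f ∈ Submodule.span ℝ (Set.range fun _ : Unit => φ 0) := by
      refine mem_span_of_iInf_ker_le_ker ?_
      rw [iInf_const]
      intro x hx
      exact LinearMap.congr_fun hf ⟨x, hx⟩
    simpa using this
  have hnot : (0 : Fin (n + 1)) ∉ Fin.succ '' (s : Set (Fin n)) := by
    rintro ⟨j, -, hj⟩
    exact Fin.succ_ne_zero j hj
  have hins := h (insert 0 (s.map (Fin.succEmb n)))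
    ((Finset.card_insert_le _ _).trans (by simpa using hs))
  rw [Finset.coe_insert, Finset.coe_map] at hins
  obtain ⟨hli, hspan⟩ := (linearIndepOn_insert hnot).1 hins
  have hli' : LinearIndepOn ℝ (fun j => φ (Fin.succ j)) (s : Set (Fin n)) :=
    LinearIndepOn.comp_of_image hli (Fin.succ_injective n).injOn
  refine LinearIndependent.map (f := r) hli' ?_
  refine Disjoint.mono_right hker ?_
  rw [Submodule.disjoint_span_singleton' (h.ne_zero (by omega) 0)]
  have himage : (Set.range fun x : (s : Set (Fin n)) => φ (Fin.succ x)) =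
      φ '' (Fin.succ '' (s : Set (Fin n))) := by
    ext f
    simp
  exact himage ▸ hspan

end Induction

lemma sum_choose_succ (n d : ℕ) :
    ∑ j ∈ Finset.range (d + 1), (n + 1).choose j =
      ∑ j ∈ Finset.range (d + 1), n.choose j + ∑ j ∈ Finset.range d, n.choose j := by
  rw [Finset.sum_range_succ', Finset.sum_range_succ' (fun j => n.choose j)]
  simp only [Nat.choose_succ_succ', Finset.sum_add_distrib, Nat.choose_zero_right]
  ring

/-- Schläfli's count: `n + 1` hyperplanes through the origin in general position cut a
`d`-dimensional space into `2 * ∑_{j < d} (n choose j)` regions. -/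
theorem ncard_signPatterns {n : ℕ} : ∀ {E : Type*} [AddCommGroup E] [Module ℝ E]
    [FiniteDimensional ℝ E] (φ : Fin (n + 1) → Module.Dual ℝ E),
    GeneralPosition (Module.finrank ℝ E) φ →
      (signPatterns φ).ncard = 2 * ∑ j ∈ Finset.range (Module.finrank ℝ E), n.choose j := by
  induction n with
  | zero =>
    intro E _ _ _ φ hφ
    rcases Nat.eq_zero_or_pos (Module.finrank ℝ E) with hd | hd
    · have := Module.finrank_zero_iff.1 hd
      simp [signPatterns_eq_empty, hd]
    · have h0 := hφ.ne_zero hd 0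
      obtain ⟨d, hd'⟩ := Nat.exists_eq_succ_of_ne_zero hd.ne'
      rw [ncard_signPatterns_succ φ h0, signPatterns_eq_univ_of_isEmpty,
        signPatterns_eq_univ_of_isEmpty, hd', Finset.sum_range_succ']
      simp [Set.ncard_univ]
  | succ n ih =>
    intro E _ _ _ φ hφ
    rcases Nat.eq_zero_or_pos (Module.finrank ℝ E) with hd | hd
    · have := Module.finrank_zero_iff.1 hd
      simp [signPatterns_eq_empty, hd]
    · have h0 := hφ.ne_zero hd 0
      have hk := Module.Dual.finrank_ker_add_one_of_ne_zero h0
      rw [ncard_signPatterns_succ φ h0, ih _ hφ.comp_succ, ih (restrictKer φ)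
        (GeneralPosition.restrictKer (by rwa [hk])), ← hk, sum_choose_succ]
      ring

/-! ### The convex hull of the columns -/

section ConvexHull

variable {m n : ℕ}

lemma mem_convexHull_range_iff {ι E : Type*} [Fintype ι] [AddCommGroup E] [Module ℝ E] (z : ι → E)
    (x : E) : x ∈ convexHull ℝ (Set.range z) ↔ ∃ w ∈ stdSimplex ℝ ι, ∑ j, w j • z j = x := by
  classical
  have : Set.range z = Fintype.linearCombination ℝ z ''
      Set.range fun i j : ι => if i = j then (1 : ℝ) else 0 := by
    rw [← Set.range_comp]
    congr 1
    ext i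
    simp [Fintype.linearCombination_apply]
  rw [this, ← LinearMap.image_convexHull, convexHull_basis_eq_stdSimplex]
  simp [Fintype.linearCombination_apply]

lemma zero_mem_convexHull_iff (z : Fin n → Fin m → ℝ) :
    (0 : Fin m → ℝ) ∈ convexHull ℝ (Set.range z) ↔
      ∃ w : Fin n → ℝ, (∀ j, 0 ≤ w j) ∧ (∃ j, 0 < w j) ∧ ∑ j, w j • z j = 0 := by
  rw [mem_convexHull_range_iff]
  constructor
  · rintro ⟨w, ⟨h0, h1⟩, hz⟩
    refine ⟨w, h0, ?_, hz⟩
    by_contra! hall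
    have := Finset.sum_nonpos fun j (_ : j ∈ Finset.univ) => hall j
    linarith
  · rintro ⟨w, h0, ⟨i, hi⟩, hz⟩
    have hs : 0 < ∑ j, w j := Finset.sum_pos' (fun j _ => h0 j) ⟨i, Finset.mem_univ i, hi⟩
    refine ⟨fun j => (∑ k, w k)⁻¹ * w j,
      ⟨fun j => mul_nonneg (inv_nonneg.2 hs.le) (h0 j), ?_⟩, ?_⟩
    · rw [← Finset.mul_sum, inv_mul_cancel₀ hs.ne']
    · simp only [mul_smul, ← Finset.smul_sum, hz, smul_zero]

/-- The origin is separated from the convex hull by a linear functional. -/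
lemma zero_notMem_convexHull_iff (z : Fin n → Fin m → ℝ) :
    (0 : Fin m → ℝ) ∉ convexHull ℝ (Set.range z) ↔ ∃ x, ∀ j, 0 < z j ⬝ᵥ x := by
  constructor
  · intro h
    obtain ⟨f, u, hu, hf⟩ := geometric_hahn_banach_point_closed (convex_convexHull ℝ _)
      ((Set.finite_range z).isClosed_convexHull ℝ) h
    refine ⟨(dotProductEquiv ℝ (Fin m)).symm f, fun j => ?_⟩
    have hj := hf _ (subset_convexHull ℝ _ ⟨j, rfl⟩)
    have heq : z j ⬝ᵥ (dotProductEquiv ℝ (Fin m)).symm f = f (z j) := by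
      rw [dotProduct_comm, ← dotProductEquiv_apply_apply, LinearEquiv.apply_symm_apply]
      rfl
    rw [heq]
    exact lt_trans (by simpa using hu) hj
  · rintro ⟨x, hx⟩ h
    obtain ⟨w, h0, ⟨i, hi⟩, hz⟩ := (zero_mem_convexHull_iff z).1 h
    have h2 : 0 < ∑ j, w j * (z j ⬝ᵥ x) :=
      Finset.sum_pos' (fun j _ => mul_nonneg (h0 j) (hx j).le)
        ⟨i, Finset.mem_univ i, mul_pos hi (hx i)⟩
    have h3 : ∑ j, w j * (z j ⬝ᵥ x) = (∑ j, w j • z j) ⬝ᵥ x := by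
      simp [sum_dotProduct]
    rw [h3, hz, zero_dotProduct] at h2
    exact lt_irrefl _ h2

lemma isOpen_setOf_zero_notMem_convexHull :
    IsOpen {z : Fin n → Fin m → ℝ | (0 : Fin m → ℝ) ∉ convexHull ℝ (Set.range z)} := by
  simp only [zero_notMem_convexHull_iff, Set.ofPred_exists, Set.ofPred_forall]
  refine isOpen_iUnion fun x => isOpen_iInter_of_finite fun j => ?_
  refine isOpen_lt continuous_const ?_
  simp only [dotProduct]
  fun_prop

/-- The sign changes of the columns moving the convex hull off the origin are counted by the
regions of the arrangement of hyperplanes orthogonal to the columns. -/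
lemma ncard_signs_zero_notMem_convexHull (hn : 1 ≤ n) {z : Fin n → Fin m → ℝ}
    (hz : GeneralPosition m z) :
    {ε : Fin n → ℤˣ | (0 : Fin m → ℝ) ∉ convexHull ℝ (Set.range fun j => ε j • z j)}.ncard =
      2 * ∑ j ∈ Finset.range m, (n - 1).choose j := by
  obtain ⟨n, rfl⟩ := Nat.exists_eq_add_of_le' hn
  have hφ : GeneralPosition m fun j => dotProductEquiv ℝ (Fin m) (z j) := fun s hs =>
    LinearIndependent.map' (hz s hs) (dotProductEquiv ℝ (Fin m)).toLinearMap
      (LinearEquiv.ker _)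
  have := ncard_signPatterns (fun j => dotProductEquiv ℝ (Fin m) (z j)) (by simpa using hφ)
  simp only [Module.finrank_fin_fun] at this
  rw [Nat.add_sub_cancel, ← this]
  congr 1
  ext ε
  simp only [zero_notMem_convexHull_iff, signPatterns, Set.mem_ofPred_eq]
  refine exists_congr fun x => forall_congr' fun j => ?_
  rcases Int.units_eq_one_or (ε j) with h | h <;> simp [h, Units.smul_def]

end ConvexHull

/-! ### The row space and its orthogonal complement -/

section RowSpace

variable {m n : ℕ}

lemma mem_rowSpace_iff (A : Matrix (Fin m) (Fin n) ℝ) (x : EuclideanSpace ℝ (Fin n)) :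
    x ∈ rowSpace A ↔ ∃ c : Fin m → ℝ, ∀ j, x j = A.col j ⬝ᵥ c := by
  rw [rowSpace, Submodule.mem_span_range_iff_exists_fun]
  refine exists_congr fun c => ?_
  constructor
  · rintro rfl j
    simp [dotProduct, mul_comm, Matrix.row, Matrix.col]
  · intro h
    ext j
    rw [h j]
    simp [dotProduct, mul_comm, Matrix.row, Matrix.col]

lemma mem_rowSpace_orthogonal_iff (A : Matrix (Fin m) (Fin n) ℝ)
    (x : EuclideanSpace ℝ (Fin n)) : x ∈ (rowSpace A)ᗮ ↔ ∑ j, x j • A.col j = 0 := by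
  rw [rowSpace, Submodule.mem_orthogonal]
  have h : ∀ i, inner ℝ (WithLp.toLp 2 (A.row i)) x = (∑ j, x j • A.col j) i := by
    intro i
    simp [PiLp.inner_apply, Matrix.row, Matrix.col]
  constructor
  · intro hx
    ext i
    rw [← h i, hx _ (Submodule.subset_span ⟨i, rfl⟩), Pi.zero_apply]
  · intro hx u hu
    induction hu using Submodule.span_induction with
    | mem u hu =>
      obtain ⟨i, rfl⟩ := hu
      rw [h i, hx, Pi.zero_apply]
    | zero => exact inner_zero_left _
    | add u v _ _ hu hv => rw [inner_add_left, hu, hv, add_zero]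
    | smul c u _ hu => rw [inner_smul_left, hu, mul_zero]

lemma finrank_rowSpace (A : Matrix (Fin m) (Fin n) ℝ) :
    Module.finrank ℝ (rowSpace A) = A.rank := by
  have : rowSpace A = (Submodule.span ℝ (Set.range A.row)).map
      (WithLp.linearEquiv 2 ℝ (Fin n → ℝ)).symm.toLinearMap := by
    rw [Submodule.map_span, ← Set.range_comp]
    rfl
  rw [this, LinearEquiv.finrank_map_eq, Matrix.rank_eq_finrank_span_row]

lemma finrank_rowSpace_of_generalPosition (hmn : m ≤ n) {A : Matrix (Fin m) (Fin n) ℝ}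
    (hA : GeneralPosition m A.col) : Module.finrank ℝ (rowSpace A) = m := by
  obtain ⟨s, -, hs⟩ := Finset.exists_subset_card_eq (s := (Finset.univ : Finset (Fin n)))
    (n := m) (by simpa using hmn)
  rw [finrank_rowSpace]
  refine le_antisymm A.rank_le_height ?_
  rw [Matrix.rank_eq_finrank_span_cols]
  have hli : LinearIndependent ℝ fun j : s => A.col j := hA s hs.le
  calc m = Fintype.card s := by rw [Fintype.card_coe, hs]
    _ = Module.finrank ℝ (Submodule.span ℝ (Set.range fun j : s => A.col j)) :=
      (finrank_span_eq_card hli).symm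
    _ ≤ _ := Submodule.finrank_mono (Submodule.span_mono (by rintro _ ⟨j, rfl⟩; exact ⟨j, rfl⟩))

lemma containsPositive_orthogonal_iff (A : Matrix (Fin m) (Fin n) ℝ) :
    ContainsPositive (rowSpace A)ᗮ ↔ (0 : Fin m → ℝ) ∈ convexHull ℝ (Set.range A.col) := by
  rw [zero_mem_convexHull_iff]
  constructor
  · rintro ⟨x, hx, h0, hpos⟩
    exact ⟨fun j => x j, h0, hpos, (mem_rowSpace_orthogonal_iff A x).1 hx⟩
  · rintro ⟨w, h0, hpos, hw⟩
    exact ⟨WithLp.toLp 2 w, (mem_rowSpace_orthogonal_iff A _).2 hw, h0, hpos⟩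

lemma containsPositive_rowSpace_of_zero_notMem (hn : 1 ≤ n) {A : Matrix (Fin m) (Fin n) ℝ}
    (h : (0 : Fin m → ℝ) ∉ convexHull ℝ (Set.range A.col)) : ContainsPositive (rowSpace A) := by
  obtain ⟨c, hc⟩ := (zero_notMem_convexHull_iff _).1 h
  exact ⟨WithLp.toLp 2 fun j => A.col j ⬝ᵥ c, (mem_rowSpace_iff A _).2 ⟨c, fun _ => rfl⟩,
    fun j => (hc j).le, ⟨0, hn⟩, hc _⟩

/-- A positive vector `x` of the row space and a positive vector `w` of its orthogonal complement
have disjoint supports, so `w` is a relation among columns lying in a common hyperplane; general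
position allows fewer than `m` of them, and makes these independent. -/
lemma zero_notMem_convexHull_of_containsPositive {A : Matrix (Fin m) (Fin n) ℝ}
    (hA : GeneralPosition m A.col) (h : ContainsPositive (rowSpace A)) :
    (0 : Fin m → ℝ) ∉ convexHull ℝ (Set.range A.col) := by
  intro h0
  obtain ⟨x, hx, hx0, i, hi⟩ := h
  obtain ⟨c, hc⟩ := (mem_rowSpace_iff A x).1 hx
  obtain ⟨w, hw0, ⟨k, hk⟩, hw⟩ := (zero_mem_convexHull_iff _).1 h0
  set S : Finset (Fin n) := {j | A.col j ⬝ᵥ c = 0}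
  have hsum : ∑ j, w j * x j = 0 := by
    have : ∑ j, w j * x j = (∑ j, w j • A.col j) ⬝ᵥ c := by
      simp [sum_dotProduct, hc]
    rw [this, hw, zero_dotProduct]
  have hzero : ∀ j, j ∉ S → w j = 0 := by
    intro j hj
    have := (Finset.sum_eq_zero_iff_of_nonneg fun j _ => mul_nonneg (hw0 j) (hx0 j)).1 hsum j
      (Finset.mem_univ j)
    refine (mul_eq_zero.1 this).resolve_right fun h => hj ?_
    simpa [S, ← hc] using h
  have hcard : S.card ≤ m := by
    by_contra! hlt
    -- `m` independent columns span the whole space, so they cannot all be orthogonal to `c ≠ 0`.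
    obtain ⟨T, hTS, hT⟩ := Finset.exists_subset_card_eq hlt.le
    have hli : LinearIndependent ℝ fun j : T => A.col j := hA T hT.le
    have hspan := hli.span_eq_top_of_card_eq_finrank' (by simp [hT])
    have hall : ∀ v : Fin m → ℝ, v ⬝ᵥ c = 0 := by
      intro v
      have hv : v ∈ Submodule.span ℝ (Set.range fun j : T => A.col j) := hspan ▸ Submodule.mem_top
      induction hv using Submodule.span_induction with
      | mem v hv =>
        obtain ⟨j, rfl⟩ := hv
        exact (Finset.mem_filter.1 (hTS j.2)).2
      | zero => exact zero_dotProduct _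
      | add u v _ _ hu hv => rw [add_dotProduct, hu, hv, add_zero]
      | smul a u _ hu => rw [smul_dotProduct, hu, smul_zero]
    rw [hc i, hall] at hi
    exact lt_irrefl _ hi
  have hkS : k ∈ S := by
    by_contra hk'
    exact hk.ne' (hzero k hk')
  have hSsum : ∑ j ∈ S, w j • A.col j = 0 := by
    rw [← hw]
    exact Finset.sum_subset (Finset.subset_univ S) fun j _ hj => by rw [hzero j hj, zero_smul]
  exact hk.ne' (linearIndepOn_finset_iff.1 (hA S hcard) w hSsum k hkS)

end RowSpace

/-! ### Almost sure general position -/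

section AlmostSure

variable {E : Type*} [NormedAddCommGroup E] [NormedSpace ℝ E]

lemma isOpen_setOf_linearIndepOn {ι : Type*} (s : Finset ι) :
    IsOpen {z : ι → E | LinearIndepOn ℝ z (s : Set ι)} := by
  have hc : Continuous fun (z : ι → E) (j : (s : Set ι)) => z j := by fun_prop
  exact (isOpen_setOfPred_linearIndependent (𝕜 := ℝ)).preimage hc

variable [FiniteDimensional ℝ E] [MeasurableSpace E] [BorelSpace E]

/-- Conditionally on the other vectors, the vector `z k` almost surely avoids the proper subspace
spanned by fewer than `dim E` of them. -/
lemma ae_linearIndepOn_insert {n : ℕ} (ν : Fin n → Measure E) [∀ i, IsProbabilityMeasure (ν i)]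
    (lam : Measure E) [lam.IsAddHaarMeasure] (hac : ∀ i, ν i ≪ lam) {k : Fin n}
    {s : Finset (Fin n)} (hk : k ∉ s) (hs : s.card < Module.finrank ℝ E) :
    ∀ᵐ z ∂Measure.pi ν, LinearIndepOn ℝ z (s : Set (Fin n)) →
      LinearIndepOn ℝ z ((insert k s : Finset (Fin n)) : Set (Fin n)) := by
  have := FiniteDimensional.proper ℝ E
  obtain ⟨n, rfl⟩ : ∃ n', n = n' + 1 := ⟨n - 1, by have := k.pos; omega⟩
  set N : Set (Fin (n + 1) → E) := {z | LinearIndepOn ℝ z (s : Set (Fin (n + 1)))} \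
    {z | LinearIndepOn ℝ z ((insert k s : Finset (Fin (n + 1))) : Set (Fin (n + 1)))}
  have hN : MeasurableSet N := (isOpen_setOf_linearIndepOn s).measurableSet.diff
    (isOpen_setOf_linearIndepOn _).measurableSet
  suffices h : Measure.pi ν N = 0 by
    rw [ae_iff]
    convert h using 2
    ext z
    simp [N]
  set e := MeasurableEquiv.piFinSuccAbove (fun _ : Fin (n + 1) => E) k
  have he := measurePreserving_piFinSuccAbove ν k
  rw [← he.symm.measure_preimage hN.nullMeasurableSet,
    Measure.prod_apply_symm (e.symm.measurable hN)]
  refine (lintegral_congr fun w => ?_).trans lintegral_zero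
  -- On the fibre over `w` the span of the vectors indexed by `s` is a fixed subspace.
  refine hac k (measure_mono_null ?_ (Measure.addHaar_submodule lam
    (Submodule.span ℝ (k.insertNth (α := fun _ => E) 0 w '' (s : Set (Fin (n + 1))))) ?_))
  · rintro x ⟨hli, hnot⟩
    have hval : e.symm (x, w) = k.insertNth (α := fun _ => E) x w := rfl
    simp only [Set.mem_ofPred_eq, Finset.coe_insert, hval] at hli hnot
    rw [linearIndepOn_insert (by simpa using hk)] at hnot
    have himage : k.insertNth (α := fun _ => E) x w '' (s : Set (Fin (n + 1))) =
        k.insertNth (α := fun _ => E) 0 w '' (s : Set (Fin (n + 1))) := by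
      refine Set.image_congr fun j hj => ?_
      obtain ⟨j, rfl⟩ := Fin.exists_succAbove_eq (x := j) (y := k) (by rintro rfl; exact hk hj)
      rw [Fin.insertNth_apply_succAbove, Fin.insertNth_apply_succAbove]
    simpa [hli, himage] using hnot
  · intro htop
    classical
    have h1 := finrank_span_finset_le_card (R := ℝ)
      (s.image (k.insertNth (α := fun _ => E) 0 w))
    rw [Finset.coe_image, Set.finrank, htop, finrank_top] at h1
    exact absurd (h1.trans Finset.card_image_le) (not_le.2 hs)

lemma ae_linearIndepOn {n : ℕ} (ν : Fin n → Measure E) [∀ i, IsProbabilityMeasure (ν i)]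
    (lam : Measure E) [lam.IsAddHaarMeasure] (hac : ∀ i, ν i ≪ lam) (s : Finset (Fin n))
    (hs : s.card ≤ Module.finrank ℝ E) :
    ∀ᵐ z ∂Measure.pi ν, LinearIndepOn ℝ z (s : Set (Fin n)) := by
  induction s using Finset.induction_on with
  | empty => simp
  | insert k s hk ih =>
    rw [Finset.card_insert_of_notMem hk] at hs
    filter_upwards [ih (by omega), ae_linearIndepOn_insert ν lam hac hk hs] with z h1 h2
    exact h2 h1

/-- Independent vectors with absolutely continuous laws are almost surely in general position. -/
lemma ae_generalPosition {n : ℕ} (ν : Fin n → Measure E) [∀ i, IsProbabilityMeasure (ν i)]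
    (lam : Measure E) [lam.IsAddHaarMeasure] (hac : ∀ i, ν i ≪ lam) :
    ∀ᵐ z ∂Measure.pi ν, GeneralPosition (Module.finrank ℝ E) z := by
  simp only [GeneralPosition, ae_all_iff]
  exact fun s hs => ae_linearIndepOn ν lam hac s hs

end AlmostSure

/-! ### Averaging over the signs -/

section Averaging

variable {m n : ℕ}

lemma p_add_p_sub (hn : 1 ≤ n) (hmn : m ≤ n) : p n m + p n (n - m) = 1 := by
  obtain ⟨n, rfl⟩ := Nat.exists_eq_add_of_le' hn
  have h : ∑ j ∈ Finset.range m, n.choose j + ∑ j ∈ Finset.range (n + 1 - m), n.choose j =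
      2 ^ n := by
    obtain ⟨k, hk⟩ := Nat.exists_eq_add_of_le hmn
    rw [← Nat.sum_range_choose n, hk, Finset.sum_range_add, Nat.add_sub_cancel_left,
      ← Finset.sum_range_reflect (fun j => n.choose j) k]
    congr 1
    refine Finset.sum_congr rfl fun j hj => ?_
    have := Finset.mem_range.1 hj
    exact Nat.choose_symm_of_eq_add (by omega)
  have h' : ∑ j ∈ Finset.range m, (n.choose j : ℝ) +
      ∑ j ∈ Finset.range (n + 1 - m), (n.choose j : ℝ) = 2 ^ n := by exact_mod_cast h
  rw [p, p, ← mul_add, Nat.add_sub_cancel, h', one_div, inv_mul_cancel₀ (by positivity)]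

lemma measurePreserving_smul_unit (ν : Measure (Fin m → ℝ)) (hν : ν.map (fun x => -x) = ν)
    (e : ℤˣ) : MeasurePreserving (fun x : Fin m → ℝ => e • x) ν ν := by
  rcases Int.units_eq_one_or e with rfl | rfl
  · simpa using! MeasurePreserving.id ν
  · simpa [Units.smul_def] using (⟨measurable_neg, hν⟩ : MeasurePreserving (fun x => -x) ν ν)

lemma HasSymmetricDensity.map_neg {Ω : Type*} [MeasurableSpace Ω] {μ : Measure Ω}
    {z : Ω → Fin m → ℝ} (h : HasSymmetricDensity z μ) :
    (μ.map z).map (fun x => -x) = μ.map z := by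
  obtain ⟨f, hf, hsymm, hmap⟩ := h
  rw [hmap]
  ext s hs
  have hs' : MeasurableSet ((fun x : Fin m → ℝ => -x) ⁻¹' s) := measurable_neg hs
  rw [Measure.map_apply measurable_neg hs, withDensity_apply _ hs', withDensity_apply _ hs,
    ← (Measure.measurePreserving_neg (volume : Measure (Fin m → ℝ))).setLIntegral_comp_preimage
      hs hf]
  simp only [hsymm]

lemma HasSymmetricDensity.absolutelyContinuous {Ω : Type*} [MeasurableSpace Ω] {μ : Measure Ω}
    {z : Ω → Fin m → ℝ} (h : HasSymmetricDensity z μ) : μ.map z ≪ volume := by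
  obtain ⟨f, -, -, hmap⟩ := h
  exact hmap ▸ withDensity_absolutelyContinuous _ _

/-- Changing signs of the vectors preserves their joint law, so the probability is the average over
all sign changes of the indicator of the event, and almost surely this average is a constant. -/
lemma pi_zero_notMem_convexHull (hn : 1 ≤ n) (ν : Fin n → Measure (Fin m → ℝ))
    [∀ i, IsProbabilityMeasure (ν i)] (hac : ∀ i, ν i ≪ volume)
    (hsymm : ∀ i, (ν i).map (fun x => -x) = ν i) :
    (Measure.pi ν).real {z | (0 : Fin m → ℝ) ∉ convexHull ℝ (Set.range z)} = p n m := by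
  classical
  set B : Set (Fin n → Fin m → ℝ) := {z | (0 : Fin m → ℝ) ∉ convexHull ℝ (Set.range z)}
  have hB : MeasurableSet B := isOpen_setOf_zero_notMem_convexHull.measurableSet
  let T : (Fin n → ℤˣ) → (Fin n → Fin m → ℝ) → (Fin n → Fin m → ℝ) := fun ε z j => ε j • z j
  have hT : ∀ ε, MeasurePreserving (T ε) (Measure.pi ν) (Measure.pi ν) := fun ε =>
    measurePreserving_pi ν ν (f := fun j x => ε j • x)
      fun j => measurePreserving_smul_unit _ (hsymm j) _
  have hint : ∀ ε ∈ (Finset.univ : Finset (Fin n → ℤˣ)),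
      Integrable ((T ε ⁻¹' B).indicator fun _ => (1 : ℝ)) (Measure.pi ν) := fun ε _ =>
    (integrable_const 1).indicator ((hT ε).measurable hB)
  have hsum : ∑ ε : Fin n → ℤˣ, (Measure.pi ν).real (T ε ⁻¹' B) =
      ∫ z, ∑ ε : Fin n → ℤˣ, (T ε ⁻¹' B).indicator (fun _ => (1 : ℝ)) z ∂Measure.pi ν := by
    rw [integral_finsetSum _ hint]
    exact Finset.sum_congr rfl fun ε _ => (integral_indicator_one ((hT ε).measurable hB)).symm
  have hconst : ∀ᵐ z ∂Measure.pi ν,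
      ∑ ε : Fin n → ℤˣ, (T ε ⁻¹' B).indicator (fun _ => (1 : ℝ)) z =
        2 * ∑ j ∈ Finset.range m, ((n - 1).choose j : ℝ) := by
    filter_upwards [ae_generalPosition ν volume hac] with z hz
    rw [Module.finrank_fin_fun] at hz
    have := ncard_signs_zero_notMem_convexHull hn hz
    rw [Set.ncard_eq_toFinset_card'] at this
    simp only [Set.indicator_apply, Finset.sum_boole]
    rw [← Nat.cast_sum, ← Nat.cast_ofNat, ← Nat.cast_mul, ← this]
    congr 2
    ext ε
    simp [B, T]
  rw [integral_congr_ae hconst, integral_const, probReal_univ, one_smul] at hsum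
  simp only [measureReal_def, (hT _).measure_preimage hB.nullMeasurableSet] at hsum
  rw [Finset.sum_const, Finset.card_univ, Fintype.card_fun, Fintype.card_units_int,
    Fintype.card_fin, nsmul_eq_mul, ← measureReal_def] at hsum
  obtain ⟨n, rfl⟩ := Nat.exists_eq_add_of_le' hn
  rw [p, Nat.add_sub_cancel, one_div, eq_inv_mul_iff_mul_eq₀ (by positivity)]
  rw [Nat.add_sub_cancel, Nat.cast_pow, pow_succ] at hsum
  push_cast at hsum
  linarith

end Averaging

end RandomSubspace

theorem mainTheorem5 {Ω : Type*} [MeasurableSpace Ω] (μ : Measure Ω) [IsProbabilityMeasure μ]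
    (n m : ℕ) (hn : 1 ≤ n) (hmn : m ≤ n)
    (A : Ω → Matrix (Fin m) (Fin n) ℝ)
    (hmeas : ∀ j, Measurable fun ω => (A ω).col j)
    (hindep : iIndepFun (fun j ω => (A ω).col j) μ)
    (hdens : ∀ j, RandomSubspace.HasSymmetricDensity (fun ω => (A ω).col j) μ) :
    -- `p(n, m)` is the probability that the convex hull of the columns misses the origin
    μ.real {ω | (0 : Fin m → ℝ) ∉ convexHull ℝ (Set.range (A ω).col)} = RandomSubspace.p n m ∧
    -- the row space is almost surely `m`-dimensional
    (∀ᵐ ω ∂μ, Module.finrank ℝ (RandomSubspace.rowSpace (A ω)) = m) ∧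
    -- it contains a positive vector with probability `p(n, m)`
    μ.real {ω | RandomSubspace.ContainsPositive (RandomSubspace.rowSpace (A ω))} =
      RandomSubspace.p n m ∧
    -- its orthogonal complement contains one with probability `p(n, n - m)`
    μ.real {ω | RandomSubspace.ContainsPositive (RandomSubspace.rowSpace (A ω))ᗮ} =
      RandomSubspace.p n (n - m) ∧
    -- almost surely exactly one of the two contains a positive vector
    (∀ᵐ ω ∂μ, Xor (RandomSubspace.ContainsPositive (RandomSubspace.rowSpace (A ω)))
      (RandomSubspace.ContainsPositive (RandomSubspace.rowSpace (A ω))ᗮ)) ∧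
    RandomSubspace.p n m + RandomSubspace.p n (n - m) = 1 := by
  have hmeasA : Measurable fun ω => (A ω).col := measurable_pi_iff.2 hmeas
  have hlaw := (iIndepFun_iff_map_fun_eq_pi_map fun j => (hmeas j).aemeasurable).1 hindep
  have hprob : ∀ j, IsProbabilityMeasure (μ.map fun ω => (A ω).col j) := fun j =>
    Measure.isProbabilityMeasure_map (hmeas j).aemeasurable
  have hgp : ∀ᵐ ω ∂μ, RandomSubspace.GeneralPosition m (A ω).col := by
    have h := RandomSubspace.ae_generalPosition (fun j => μ.map fun ω => (A ω).col j) volume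
      fun j => (hdens j).absolutelyContinuous
    rw [← hlaw, Module.finrank_fin_fun] at h
    exact ae_of_ae_map hmeasA.aemeasurable h
  have hopen := RandomSubspace.isOpen_setOf_zero_notMem_convexHull (m := m) (n := n)
  have hset : MeasurableSet {ω | (0 : Fin m → ℝ) ∉ convexHull ℝ (Set.range (A ω).col)} :=
    hmeasA hopen.measurableSet
  have hhull : μ.real {ω | (0 : Fin m → ℝ) ∉ convexHull ℝ (Set.range (A ω).col)} =
      RandomSubspace.p n m := by
    rw [← RandomSubspace.pi_zero_notMem_convexHull hn (fun j => μ.map fun ω => (A ω).col j)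
      (fun j => (hdens j).absolutelyContinuous) (fun j => (hdens j).map_neg), ← hlaw,
      map_measureReal_apply hmeasA hopen.measurableSet]
    rfl
  have hrow : ∀ᵐ ω ∂μ, RandomSubspace.ContainsPositive (RandomSubspace.rowSpace (A ω)) ↔
      (0 : Fin m → ℝ) ∉ convexHull ℝ (Set.range (A ω).col) := by
    filter_upwards [hgp] with ω hω
    exact ⟨RandomSubspace.zero_notMem_convexHull_of_containsPositive hω,
      RandomSubspace.containsPositive_rowSpace_of_zero_notMem hn⟩
  have hp := RandomSubspace.p_add_p_sub hn hmn
  refine ⟨hhull, ?_, ?_, ?_, ?_, hp⟩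
  · filter_upwards [hgp] with ω hω
    exact RandomSubspace.finrank_rowSpace_of_generalPosition hmn hω
  · rw [← hhull]
    refine measureReal_congr ?_
    filter_upwards [hrow] with ω hω
    exact propext hω
  · have hcompl : {ω | RandomSubspace.ContainsPositive (RandomSubspace.rowSpace (A ω))ᗮ} =
        {ω | (0 : Fin m → ℝ) ∉ convexHull ℝ (Set.range (A ω).col)}ᶜ := by
      ext ω
      simp [RandomSubspace.containsPositive_orthogonal_iff]
    rw [hcompl, probReal_compl_eq_one_sub hset, hhull]
    linarith
  · filter_upwards [hrow] with ω hω
    rw [hω, RandomSubspace.containsPositive_orthogonal_iff, xor_comm]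
    exact xor_not_right.2 Iff.rfl
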